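/- Let $G$ be a Polish group, i.e. a separable, completely metrizable topological group. A $G$-flow is a continuous action of $G$ on a nonempty compact Hausdorff space; it is minimal if all of its orbits are dense. Let $M(G)$ be the universal minimal flow of $G$, i.e. the (unique up to isomorphism) minimal $G$-flow that maps continuously and $G$-equivariantly onto every minimal $G$-flow. If $M(G)$ is metrizable, then $M(G)$ has a comeagre orbit, i.e. there is $x \in M(G)$ such that the complement of the orbit $G \cdot x$ is a countable union of nowhere dense subsets of $M(G)$. -/

import Mathlib

open TopologicalSpace

universe u

/-- A minimal `G`-flow: a continuous action of the topological group `G` on a nonempty compact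
Hausdorff space all of whose orbits are dense. -/
structure IsMinimalFlow (G X : Type u) [Group G] [TopologicalSpace G] [TopologicalSpace X]
    [MulAction G X] : Prop where
  compactSpace : CompactSpace X
  t2Space : T2Space X
  nonempty : Nonempty X
  continuousSMul : ContinuousSMul G X
  dense_orbit : ∀ x : X, Dense (MulAction.orbit G x)

/-- A universal minimal flow of `G`: a minimal `G`-flow that maps continuously and equivariantly
onto every minimal `G`-flow. (For a topological group `G : Type u` such a flow exists in `Type u`,
and it is unique up to isomorphism; every minimal `G`-flow is isomorphic to one in `Type u`
because it is a factor of the greatest ambit, which lives in `Type u`.) -/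
structure IsUniversalMinimalFlow (G M : Type u) [Group G] [TopologicalSpace G]
    [TopologicalSpace M] [MulAction G M] : Prop extends IsMinimalFlow G M where
  exists_factor_map : ∀ (X : Type u) [TopologicalSpace X] [MulAction G X], IsMinimalFlow G X →
    ∃ π : M → X, Continuous π ∧ Function.Surjective π ∧ ∀ (g : G) (m : M), π (g • m) = g • π m

/-! The key is a separation property of universal minimal flows: if no `v ∈ V` maps a point of the
open set `A` into the open set `C`, a continuous function on `M` is 0 on `A` and 1 on `C`, with a
modulus along the action depending only on `V` (`IsUniversalMinimalFlow.exists_modulus_separating`).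
It is built along one orbit, joined to `M` as a second coordinate, and carried to all of `M` by
universality and coalescence.

If `M` is metrizable, pairwise `V`-separated open sets cannot contain points converging to some `x`:
a function that is 0 on the even sets and 1 on the odd ones would be discontinuous at `x`. Hence
near every point, nonempty open sets are linked by elements of `V`. By Baire category, for
comeagrely many `x` every `V • x` is dense near `x`, and a back-and-forth in the complete space `G`
puts all such points in one orbit. -/

open Filter Topology Set

/-! ### Minimal sets in flows. -/

section Minimal

variable {G X : Type u} [Group G] [TopologicalSpace G] [TopologicalSpace X] [MulAction G X]

/-- In a minimal flow, a nonempty closed invariant set is everything. -/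
theorem IsMinimalFlow.eq_univ_of_invariant (hX : IsMinimalFlow G X) {S : Set X} (hS : IsClosed S)
    (hne : S.Nonempty) (hinv : ∀ (g : G), ∀ x ∈ S, g • x ∈ S) : S = univ := by
  obtain ⟨x, hx⟩ := hne
  rw [← univ_subset_iff, ← (hX.dense_orbit x).closure_eq]
  refine closure_minimal ?_ hS
  rintro _ ⟨g, rfl⟩
  exact hinv g x hx

theorem IsMinimalFlow.surjective_of_equivariant {Y : Type u} [TopologicalSpace Y] [MulAction G Y]
    (hX : IsMinimalFlow G X) [CompactSpace Y] [Nonempty Y] {f : Y → X} (hf : Continuous f)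
    (hequiv : ∀ (g : G) (y : Y), f (g • y) = g • f y) : Function.Surjective f := by
  have := hX.t2Space
  rw [← range_eq_univ]
  refine hX.eq_univ_of_invariant (isCompact_range hf).isClosed (range_nonempty f) ?_
  rintro g _ ⟨y, rfl⟩
  exact ⟨g • y, hequiv g y⟩

/-- Every nonempty closed invariant subset of a compact Hausdorff flow contains a minimal flow. -/
theorem exists_le_isMinimalFlow [CompactSpace X] [T2Space X] [ContinuousSMul G X]
    (S : SubMulAction G X) (hS : IsClosed (S : Set X)) (hne : (S : Set X).Nonempty) :
    ∃ I : SubMulAction G X, I ≤ S ∧ IsClosed (I : Set X) ∧ IsMinimalFlow G I := by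
  let C : Set (Set X) :=
    {N | IsClosed N ∧ N.Nonempty ∧ ∀ (g : G), ∀ x ∈ N, g • x ∈ N}
  obtain ⟨N, hNS, hN⟩ : ∃ N ⊆ (S : Set X), Minimal (· ∈ C) N := by
    refine zorn_superset_nonempty C (fun c hcC hc hcne => ?_) S
      ⟨hS, hne, fun g x hx => S.smul_mem g hx⟩
    refine ⟨⋂₀ c, ⟨isClosed_sInter fun t ht => (hcC ht).1, ?_, fun g x hx t ht =>
      (hcC ht).2.2 g x (hx t ht)⟩, fun s hs => sInter_subset_of_mem hs⟩
    exact IsCompact.nonempty_sInter_of_directed_nonempty_isCompact_isClosed (hS := hcne.to_subtype)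
      (IsChain.directedOn hc.symm) (fun t ht => (hcC ht).2.1)
      (fun t ht => (hcC ht).1.isCompact) (fun t ht => (hcC ht).1)
  obtain ⟨hNc, hNne, hNinv⟩ := hN.prop
  let I : SubMulAction G X := ⟨N, fun g {x} hx => hNinv g x hx⟩
  refine ⟨I, hNS, hNc, isCompact_iff_compactSpace.mp hNc.isCompact, inferInstance, hNne.to_subtype,
    ⟨?_⟩, fun x => ?_⟩
  · exact Continuous.subtype_mk (by fun_prop) _
  · have hcl : closure (MulAction.orbit G (x : X)) = N := by
      refine hN.eq_of_subset ⟨isClosed_closure, (MulAction.nonempty_orbit _).closure, ?_⟩ ?_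
      · intro g y hy
        refine map_mem_closure (continuous_const_smul g) hy ?_
        rintro _ ⟨h, rfl⟩
        exact ⟨g * h, mul_smul _ _ _⟩
      · refine closure_minimal ?_ hNc
        rintro _ ⟨h, rfl⟩
        exact hNinv h _ x.2
    intro y
    rw [closure_subtype]
    have : Subtype.val '' MulAction.orbit G x = MulAction.orbit G (x : X) := by
      ext z
      constructor
      · rintro ⟨_, ⟨g, rfl⟩, rfl⟩
        exact ⟨g, rfl⟩
      · rintro ⟨g, rfl⟩
        exact ⟨g • x, ⟨g, rfl⟩, rfl⟩
    rw [this, hcl]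
    exact y.2

end Minimal

/-! ### Minimal left ideals of the Ellis semigroup, and coalescence. -/

section Ellis

variable {G M : Type u} [Group G] [TopologicalSpace M] [MulAction G M]

variable (G M) in
/-- The Ellis (enveloping) semigroup of a flow, as an invariant set of self-maps. -/
def ellisSemigroup [ContinuousConstSMul G M] : SubMulAction G (M → M) where
  carrier := closure (range fun (g : G) (x : M) => g • x)
  smul_mem' g p hp := by
    refine map_mem_closure (continuous_const_smul g) hp ?_
    rintro _ ⟨h, rfl⟩
    exact ⟨g * h, funext fun x => mul_smul _ _ _⟩

theorem isClosed_ellisSemigroup [ContinuousConstSMul G M] :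
    IsClosed (ellisSemigroup G M : Set (M → M)) :=
  isClosed_closure

theorem ellisSemigroup_induction [ContinuousConstSMul G M] {S : Set (M → M)} (hS : IsClosed S)
    (h : ∀ g : G, (fun x : M => g • x) ∈ S) {p : M → M} (hp : p ∈ ellisSemigroup G M) : p ∈ S :=
  closure_minimal (range_subset_iff.mpr h) hS hp

theorem comp_mem_of_mem_ellisSemigroup [ContinuousConstSMul G M] {I : SubMulAction G (M → M)}
    (hI : IsClosed (I : Set (M → M))) {p q : M → M} (hp : p ∈ ellisSemigroup G M) (hq : q ∈ I) :
    p ∘ q ∈ I := by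
  have hc : Continuous fun p : M → M => p ∘ q := by fun_prop
  exact ellisSemigroup_induction (hI.preimage hc) (fun g => I.smul_mem g hq) hp

/-- A continuous equivariant map into the space of self-maps commutes with the Ellis semigroup. -/
theorem apply_eq_comp_of_mem_ellisSemigroup [ContinuousConstSMul G M] [T2Space M]
    {Ψ : M → M → M} (hΨ : Continuous Ψ) (hequiv : ∀ (g : G) (m : M), Ψ (g • m) = g • Ψ m)
    {p : M → M} (hp : p ∈ ellisSemigroup G M) (m : M) : Ψ (p m) = p ∘ Ψ m := by
  have hc : Continuous fun p : M → M => p ∘ Ψ m := by fun_prop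
  exact ellisSemigroup_induction (isClosed_eq (hΨ.comp (continuous_apply m)) hc)
    (fun g => hequiv g m) hp

variable [TopologicalSpace G] [ContinuousConstSMul G M] {I : SubMulAction G (M → M)}

/-- Right composition with `s` is a continuous equivariant self-map of the minimal flow `I`, hence
onto. -/
theorem exists_comp_eq_of_minimal (hI : IsClosed (I : Set (M → M))) (hmin : IsMinimalFlow G I)
    (hIE : I ≤ ellisSemigroup G M) {s t : M → M} (hs : s ∈ I) (ht : t ∈ I) :
    ∃ p ∈ I, p ∘ s = t := by
  let f : I → I := fun p => ⟨p.1 ∘ s, comp_mem_of_mem_ellisSemigroup hI (hIE p.2) hs⟩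
  have hf : Continuous f := by
    refine Continuous.subtype_mk ?_ _
    exact continuous_pi fun x => (continuous_apply (s x)).comp continuous_subtype_val
  have := hmin.compactSpace
  have := hmin.nonempty
  obtain ⟨p, hp⟩ := hmin.surjective_of_equivariant hf (fun g p => rfl) ⟨t, ht⟩
  exact ⟨p.1, p.2, congrArg Subtype.val hp⟩

/-- Elements of a minimal left ideal of the Ellis semigroup can be cancelled on the right. -/
theorem comp_right_cancel_of_minimal [CompactSpace M] [T2Space M] (hI : IsClosed (I : Set (M → M))) (hmin : IsMinimalFlow G I)
    (hIE : I ≤ ellisSemigroup G M) {p q s : M → M} (hp : p ∈ I) (hq : q ∈ I) (hs : s ∈ I)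
    (h : p ∘ s = q ∘ s) : p = q := by
  let _ : Semigroup (M → M) := { mul := fun a b => a ∘ b, mul_assoc := fun _ _ _ => rfl }
  have hcont : ∀ r : M → M, Continuous fun a : M → M => a ∘ r := fun r => by fun_prop
  -- Ellis–Numakura, applied to the compact semigroup of elements of `I` fixing `s` on the left.
  obtain ⟨v, ⟨hvI, hvs⟩, hvv⟩ := exists_idempotent_in_compact_subsemigroup (M := M → M) hcont
    {a | a ∈ I ∧ a ∘ s = s} (exists_comp_eq_of_minimal hI hmin hIE hs hs)
    ((hI.inter (isClosed_eq (hcont s) continuous_const)).isCompact)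
    (fun a ha b hb => ⟨comp_mem_of_mem_ellisSemigroup hI (hIE ha.1) hb.1, by
      change a ∘ (b ∘ s) = s
      rw [hb.2, ha.2]⟩)
  replace hvv : v ∘ v = v := hvv
  have hright : ∀ a ∈ I, a ∘ v = a := by
    intro a ha
    obtain ⟨b, -, rfl⟩ := exists_comp_eq_of_minimal hI hmin hIE hvI ha
    rw [Function.comp_assoc, hvv]
  -- `t` inverts `s` on the left up to `v`. The left inverse `r` of `v ∘ t` turns out to be `s`, so
  -- `s ∘ t = v` as well, and composing with `t` cancels `s`.
  obtain ⟨t, ht, hts⟩ := exists_comp_eq_of_minimal hI hmin hIE hs hvI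
  obtain ⟨r, hr, hrt⟩ := exists_comp_eq_of_minimal hI hmin hIE
    (comp_mem_of_mem_ellisSemigroup hI (hIE hvI) ht) hvI
  have hrs : r = s := by
    rw [← hright r hr, ← hvv]
    nth_rw 2 [← hts]
    rw [← Function.comp_assoc v t s, ← Function.comp_assoc, hrt, hvs]
  have hst : s ∘ t = v := by
    rw [← hrt, hrs, ← Function.comp_assoc, hright s hs]
  rw [← hright p hp, ← hright q hq, ← hst, ← Function.comp_assoc, h, Function.comp_assoc]

end Ellis

/-- Universal minimal flows are coalescent: their endomorphisms are injective. -/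
theorem IsUniversalMinimalFlow.injective_endomorphism {G M : Type u} [Group G] [TopologicalSpace G]
    [TopologicalSpace M] [MulAction G M] (hM : IsUniversalMinimalFlow G M) {φ : M → M}
    (hφ : Continuous φ) (hequiv : ∀ (g : G) (m : M), φ (g • m) = g • φ m) :
    Function.Injective φ := by
  have := hM.compactSpace
  have := hM.t2Space
  have := hM.continuousSMul
  obtain ⟨x⟩ := hM.nonempty
  obtain ⟨I, hIE, hI, hmin⟩ := exists_le_isMinimalFlow (ellisSemigroup G M)
    isClosed_ellisSemigroup ⟨_, subset_closure ⟨1, rfl⟩⟩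
  obtain ⟨π, hπ, -, hπe⟩ := hM.exists_factor_map I hmin
  let Ψ : M → M → M := fun m => (π (φ m)).1
  have hΨ : Continuous Ψ := continuous_subtype_val.comp (hπ.comp hφ)
  have hΨe : ∀ (g : G) (m : M), Ψ (g • m) = g • Ψ m := fun g m => by
    simp only [Ψ, hequiv, hπe]
    rfl
  have := hmin.compactSpace
  have := hmin.nonempty
  -- Points of `M` have the form `p x` with `p ∈ I`, and `Ψ (p x) = p ∘ Ψ x`, so injectivity becomes
  -- right cancellation in `I`.
  have hsurj : Function.Surjective fun p : I => p.1 x :=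
    hM.surjective_of_equivariant ((continuous_apply x).comp continuous_subtype_val)
      fun g p => rfl
  intro m m' h
  obtain ⟨p, rfl⟩ := hsurj m
  obtain ⟨q, rfl⟩ := hsurj m'
  have hcomp : p.1 ∘ Ψ x = q.1 ∘ Ψ x := by
    rw [← apply_eq_comp_of_mem_ellisSemigroup hΨ hΨe (hIE p.2),
      ← apply_eq_comp_of_mem_ellisSemigroup hΨ hΨe (hIE q.2)]
    exact congrArg (fun y => (π y).1) h
  exact congrFun (comp_right_cancel_of_minimal hI hmin hIE p.2 q.2 (π (φ x)).2 hcomp) x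

/-! ### Right uniformly continuous functions with a fixed modulus. -/

section Modulus

variable {G : Type u} [Group G] [TopologicalSpace G]

/-- On a first countable group, right-separated sets can be separated by functions admitting a
common modulus of right uniform continuity. -/
theorem exists_modulus_separating [IsTopologicalGroup G] [FirstCountableTopology G] {V : Set G}
    (hV : V ∈ 𝓝 (1 : G)) :
    ∃ ω : G → ℝ, Tendsto ω (𝓝 1) (𝓝 0) ∧ ∀ S T : Set G, (∀ v ∈ V, ∀ s ∈ S, v * s ∉ T) →
      ∃ f : G → ℝ, (∀ g, f g ∈ Icc (0 : ℝ) 1) ∧ (∀ v g, |f (v * g) - f g| ≤ ω v) ∧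
        (∀ s ∈ S, f s = 0) ∧ ∀ t ∈ T, f t = 1 := by
  let _ : UniformSpace G := IsTopologicalGroup.rightUniformSpace G
  have hU : uniformity G = comap (fun p : G × G => p.2 * p.1⁻¹) (𝓝 (1 : G)) :=
    uniformity_eq_comap_nhds_one' G
  have : IsCountablyGenerated (uniformity G) := by
    rw [hU]
    infer_instance
  let _ : PseudoMetricSpace G := UniformSpace.pseudoMetricSpace G
  obtain ⟨δ, hδ, hδV⟩ : ∃ δ > (0 : ℝ), ∀ a b : G, dist a b < δ → b * a⁻¹ ∈ V := by
    have h : (fun p : G × G => p.2 * p.1⁻¹) ⁻¹' V ∈ uniformity G := by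
      rw [hU]
      exact preimage_mem_comap hV
    obtain ⟨δ, hδ, h⟩ := Metric.mem_uniformity_dist.mp h
    exact ⟨δ, hδ, fun a b hab => h hab⟩
  have hdist : ∀ ε > (0 : ℝ), ∀ᶠ v in 𝓝 (1 : G), ∀ g, dist (v * g) g < ε := by
    intro ε hε
    have h := Metric.dist_mem_uniformity (α := G) hε
    rw [hU] at h
    obtain ⟨W, hW, hWsub⟩ := h
    filter_upwards [hW] with v hv g
    rw [dist_comm]
    exact hWsub (a := (g, v * g)) (by simpa using hv)
  -- The cap at 1 keeps the supremum over `g` finite; nothing here depends on `S` or `T`.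
  let ρ : G → G → ℝ := fun v g => min 1 (dist (v * g) g / δ)
  have hρ0 : ∀ v g, 0 ≤ ρ v g := fun v g => le_min zero_le_one (by positivity)
  have hbdd : ∀ v, BddAbove (range (ρ v)) := fun v =>
    ⟨1, by rintro _ ⟨g, rfl⟩; exact min_le_left _ _⟩
  refine ⟨fun v => ⨆ g, ρ v g, ?_, fun S T hST => ?_⟩
  · refine tendsto_order.mpr ⟨fun a ha => Eventually.of_forall fun v =>
      ha.trans_le (Real.iSup_nonneg (hρ0 v)), fun a ha => ?_⟩
    filter_upwards [hdist (a / 2 * δ) (by positivity)] with v hv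
    refine (ciSup_le fun g => ?_).trans_lt (half_lt_self ha)
    exact (min_le_right _ _).trans ((div_lt_iff₀ hδ).mpr (hv g)).le
  · have hω0 : ∀ v, 0 ≤ ⨆ g, ρ v g := fun v => Real.iSup_nonneg (hρ0 v)
    -- `Metric.infDist` to the empty set is 0, so the general formula fails here.
    obtain rfl | hS := S.eq_empty_or_nonempty
    · exact ⟨fun _ => 1, fun _ => by simp, fun v g => by simpa using hω0 v, by simp, by simp⟩
    refine ⟨fun g => min 1 (Metric.infDist g S / δ), fun g => ⟨le_min zero_le_one
      (div_nonneg Metric.infDist_nonneg hδ.le), min_le_left _ _⟩, fun v g => ?_, fun s hs => ?_,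
      fun t ht => ?_⟩
    · refine le_trans (le_min ?_ ?_) (le_ciSup (hbdd v) g)
      · have h0 : ∀ g, 0 ≤ Metric.infDist g S / δ := fun g =>
          div_nonneg Metric.infDist_nonneg hδ.le
        rw [abs_sub_le_iff]
        constructor <;>
          linarith [min_le_left (1 : ℝ) (Metric.infDist (v * g) S / δ), le_min zero_le_one (h0 g),
            min_le_left (1 : ℝ) (Metric.infDist g S / δ), le_min zero_le_one (h0 (v * g))]
      · refine (abs_min_sub_min_le_max _ _ _ _).trans ?_
        rw [sub_self, abs_zero, max_eq_right (abs_nonneg _), ← sub_div, abs_div, abs_of_pos hδ]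
        gcongr
        rw [abs_sub_le_iff]
        constructor
        · linarith [Metric.infDist_le_infDist_add_dist (s := S) (x := v * g) (y := g)]
        · linarith [Metric.infDist_le_infDist_add_dist (s := S) (x := g) (y := v * g),
            dist_comm (v * g) g]
    · simp [Metric.infDist_zero_of_mem hs]
    · refine min_eq_left ((one_le_div hδ).mpr ?_)
      refine (Metric.le_infDist hS).mpr fun {s} hs => ?_
      by_contra! hlt
      refine hST _ (hδV s t (by rwa [dist_comm])) s hs ?_
      rwa [inv_mul_cancel_right]

/-- The `[0, 1]`-valued functions on a group with modulus of right uniform continuity `ω`. -/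
@[ext]
structure ModulusFun {G : Type u} [Group G] (ω : G → ℝ) : Type u where
  /-- The underlying function. -/
  val : G → ℝ
  mem_Icc : ∀ g, val g ∈ Icc (0 : ℝ) 1
  abs_sub_le : ∀ v g, |val (v * g) - val g| ≤ ω v

namespace ModulusFun

variable {ω : G → ℝ}

instance {G : Type u} [Group G] {ω : G → ℝ} : TopologicalSpace (ModulusFun ω) :=
  TopologicalSpace.induced val inferInstance

theorem isClosedEmbedding_val {G : Type u} [Group G] {ω : G → ℝ} :
    IsClosedEmbedding (val : ModulusFun ω → G → ℝ) := by
  refine ⟨⟨⟨rfl⟩, fun k l h => ModulusFun.ext h⟩, ?_⟩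
  have : range (val : ModulusFun ω → G → ℝ) =
      (⋂ g, {k | k g ∈ Icc (0 : ℝ) 1}) ∩ ⋂ v, ⋂ g, {k | |k (v * g) - k g| ≤ ω v} := by
    ext k
    simp only [mem_inter_iff, mem_iInter, mem_ofPred_eq, mem_range]
    exact ⟨fun ⟨l, hl⟩ => hl ▸ ⟨l.mem_Icc, l.abs_sub_le⟩, fun h => ⟨⟨k, h.1, h.2⟩, rfl⟩⟩
  rw [this]
  refine (isClosed_iInter fun g => isClosed_Icc.preimage (continuous_apply g)).inter ?_
  exact isClosed_iInter fun v => isClosed_iInter fun g =>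
    isClosed_le (by fun_prop) continuous_const

theorem continuous_val {G : Type u} [Group G] {ω : G → ℝ} :
    Continuous (val : ModulusFun ω → G → ℝ) :=
  isClosedEmbedding_val.continuous

instance {G : Type u} [Group G] {ω : G → ℝ} : T2Space (ModulusFun ω) :=
  isClosedEmbedding_val.isEmbedding.t2Space

instance {G : Type u} [Group G] {ω : G → ℝ} : CompactSpace (ModulusFun ω) := by
  have h := isClosedEmbedding_val.isCompact_preimage
    (isCompact_univ_pi fun _ : G => isCompact_Icc (a := (0 : ℝ)) (b := 1)) (X := ModulusFun ω)
  refine ⟨h.of_isClosed_subset isClosed_univ fun k _ g _ => k.mem_Icc g⟩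

instance {G : Type u} [Group G] {ω : G → ℝ} : MulAction G (ModulusFun ω) where
  smul g k := ⟨fun h => k.val (h * g), fun h => k.mem_Icc _, fun v h => by
    simpa only [mul_assoc] using k.abs_sub_le v (h * g)⟩
  one_smul k := ModulusFun.ext (funext fun h => congrArg k.val (mul_one h))
  mul_smul g g' k := ModulusFun.ext (funext fun h => congrArg k.val (mul_assoc h g g').symm)

/-- Pointwise convergence suffices for joint continuity because all the functions share the modulus
`ω`. -/
theorem continuousSMul [IsTopologicalGroup G] (hω : Tendsto ω (𝓝 1) (𝓝 0)) :
    ContinuousSMul G (ModulusFun ω) := by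
  refine ⟨isClosedEmbedding_val.isEmbedding.continuous_iff.mpr (continuous_pi fun h => ?_)⟩
  rw [continuous_iff_continuousAt]
  rintro ⟨g₀, k₀⟩
  have hv : Continuous fun p : G × ModulusFun ω => h * p.1 * (h * g₀)⁻¹ := by fun_prop
  have hv1 : Tendsto (fun p : G × ModulusFun ω => h * p.1 * (h * g₀)⁻¹) (𝓝 (g₀, k₀)) (𝓝 1) := by
    simpa using hv.tendsto (g₀, k₀)
  have hk : Continuous fun p : G × ModulusFun ω => p.2.val (h * g₀) :=
    (continuous_apply _).comp (continuous_val.comp continuous_snd)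
  have hlim : Tendsto (fun p : G × ModulusFun ω => p.2.val (h * p.1) - p.2.val (h * g₀))
      (𝓝 (g₀, k₀)) (𝓝 0) := by
    refine squeeze_zero_norm (fun p => ?_) (hω.comp hv1)
    have := p.2.abs_sub_le (h * p.1 * (h * g₀)⁻¹) (h * g₀)
    rwa [inv_mul_cancel_right] at this
  have := hlim.add (hk.tendsto (g₀, k₀))
  simp only [zero_add, sub_add_cancel] at this
  exact this

end ModulusFun

end Modulus

/-- On a universal minimal flow, open sets separated by a neighbourhood of the identity are
separated by continuous functions with a common modulus along the action. -/
theorem IsUniversalMinimalFlow.exists_modulus_separating {G M : Type u} [Group G]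
    [TopologicalSpace G] [IsTopologicalGroup G] [FirstCountableTopology G] [TopologicalSpace M]
    [MulAction G M] (hM : IsUniversalMinimalFlow G M) {V : Set G} (hV : V ∈ 𝓝 (1 : G)) :
    ∃ ω : G → ℝ, Tendsto ω (𝓝 1) (𝓝 0) ∧ ∀ A C : Set M, IsOpen A → IsOpen C →
      (∀ v ∈ V, ∀ a ∈ A, v • a ∉ C) →
      ∃ h : M → ℝ, Continuous h ∧ (∀ v m, |h (v • m) - h m| ≤ ω v) ∧
        (∀ a ∈ A, h a = 0) ∧ ∀ c ∈ C, h c = 1 := by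
  have := hM.compactSpace
  have := hM.t2Space
  have := hM.continuousSMul
  obtain ⟨x⟩ := hM.nonempty
  obtain ⟨ω, hω, hsep⟩ := _root_.exists_modulus_separating hV
  refine ⟨ω, hω, fun A C hA hC hAC => ?_⟩
  obtain ⟨f, hf01, hfω, hfA, hfC⟩ := hsep {g | g • x ∈ A} {g | g • x ∈ C} fun v hv s hs => by
    simpa [mul_smul] using hAC v hv _ hs
  have := ModulusFun.continuousSMul hω
  let k₀ : ModulusFun ω := ⟨f, hf01, hfω⟩
  let S : SubMulAction G (M × ModulusFun ω) :=
    { carrier := closure (MulAction.orbit G (x, k₀))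
      smul_mem' := fun g z hz => by
        refine map_mem_closure (continuous_const_smul g) hz ?_
        rintro _ ⟨h, rfl⟩
        exact ⟨g * h, mul_smul _ _ _⟩ }
  -- This condition holds on the orbit of `(x, k₀)` and is closed because `B` is open.
  have hval : ∀ (B : Set M) (r : ℝ), IsOpen B → (∀ g : G, g • x ∈ B → f g = r) →
      ∀ z ∈ S, z.1 ∈ B → z.2.val 1 = r := by
    intro B r hB hBr z hz hzB
    have hcl : IsClosed {z : M × ModulusFun ω | z.1 ∈ Bᶜ ∨ z.2.val 1 = r} := by
      refine IsClosed.union (hB.isClosed_compl.preimage continuous_fst) (isClosed_eq ?_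
        continuous_const)
      exact (continuous_apply 1).comp (ModulusFun.continuous_val.comp continuous_snd)
    refine (closure_minimal ?_ hcl hz).resolve_left (not_not.mpr hzB)
    rintro _ ⟨g, rfl⟩
    refine or_iff_not_imp_left.mpr fun hg => ?_
    change f (1 * g) = r
    rw [one_mul]
    exact hBr g (not_not.mp hg)
  obtain ⟨I, hIS, hI, hmin⟩ := exists_le_isMinimalFlow S isClosed_closure
    (MulAction.nonempty_orbit _).closure
  obtain ⟨π, hπ, -, hπe⟩ := hM.exists_factor_map I hmin
  -- By coalescence `φ` is an automorphism; precomposing with its inverse makes the first coordinate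
  -- the identity.
  let φ : M → M := fun m => (π m).1.1
  have hφ : Continuous φ := continuous_fst.comp (continuous_subtype_val.comp hπ)
  have hφe : ∀ (g : G) (m : M), φ (g • m) = g • φ m := fun g m => by
    simp only [φ, hπe]
    rfl
  have := hM.nonempty
  have hbij : Function.Bijective φ :=
    ⟨hM.injective_endomorphism hφ hφe, hM.surjective_of_equivariant hφ hφe⟩
  let e : M ≃ₜ M := Continuous.homeoOfEquivCompactToT2 (f := Equiv.ofBijective φ hbij) hφ
  have he : ∀ m, φ (e.symm m) = m := e.apply_symm_apply
  have hee : ∀ (g : G) (m : M), e.symm (g • m) = g • e.symm m := fun g m =>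
    hbij.1 (by rw [hφe, he, he])
  refine ⟨fun m => (π (e.symm m)).1.2.val 1, ?_, fun v m => ?_, fun a ha => ?_, fun c hc => ?_⟩
  · exact (continuous_apply 1).comp (ModulusFun.continuous_val.comp (continuous_snd.comp
      (continuous_subtype_val.comp (hπ.comp e.symm.continuous))))
  · simp only [hee, hπe]
    have := (π (e.symm m)).1.2.abs_sub_le v 1
    rw [mul_one] at this
    change |(π (e.symm m)).1.2.val (1 * v) - _| ≤ _
    rwa [one_mul]
  · refine hval A 0 hA hfA _ (hIS (π (e.symm a)).2) ?_
    change φ (e.symm a) ∈ _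
    rwa [he]
  · refine hval C 1 hC hfC _ (hIS (π (e.symm c)).2) ?_
    change φ (e.symm c) ∈ _
    rwa [he]

/-! ### Local topological transitivity. -/

section Separation

variable {G M : Type u} [Group G] [TopologicalSpace G] [IsTopologicalGroup G]
  [FirstCountableTopology G] [TopologicalSpace M] [MulAction G M]

/-- In a first countable universal minimal flow, points close to `x` cannot be separated from `x`
by a given symmetric neighbourhood of the identity. -/
theorem IsUniversalMinimalFlow.exists_nhds_not_separated_from [FirstCountableTopology M]
    (hM : IsUniversalMinimalFlow G M) {V : Set G} (hV : V ∈ 𝓝 (1 : G))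
    (hsymm : ∀ v ∈ V, v⁻¹ ∈ V) (x : M) :
    ∃ O ∈ 𝓝 x, ∀ y ∈ O, ∀ A B : Set M, IsOpen A → IsOpen B → y ∈ A → x ∈ B →
      ∃ v ∈ V, ∃ a ∈ A, v • a ∈ B := by
  by_contra! hneg
  obtain ⟨U, hU⟩ := (𝓝 x).exists_antitone_basis
  -- Shrinking `B` around `x` puts all later sets `A` inside `B'`, hence separated from the present
  -- one.
  have hstep : ∀ (n : ℕ) (B : {B : Set M // IsOpen B ∧ x ∈ B}),
      ∃ (y : M) (A : Set M) (B' : {B : Set M // IsOpen B ∧ x ∈ B}), y ∈ U n ∧ y ∈ A ∧ IsOpen A ∧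
        A ⊆ B ∧ B'.1 ⊆ B ∧ ∀ v ∈ V, ∀ a ∈ A, v • a ∉ B'.1 := by
    rintro n ⟨B, hB, hxB⟩
    obtain ⟨y, hy, A, B', hA, hB', hyA, hxB', hAB⟩ :=
      hneg (U n ∩ B) (inter_mem (hU.mem n) (hB.mem_nhds hxB))
    exact ⟨y, A ∩ B, ⟨B' ∩ B, hB'.inter hB, hxB', hxB⟩, hy.1, ⟨hyA, hy.2⟩, hA.inter hB,
      inter_subset_right, inter_subset_right, fun v hv a ha h => hAB v hv a ha.1 h.1⟩
  choose y A B hyU hyA hAo hAB hBB hsep using hstep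
  let Bs : ℕ → {B : Set M // IsOpen B ∧ x ∈ B} :=
    Nat.rec ⟨univ, isOpen_univ, mem_univ x⟩ fun n b => B n b
  have hBs : Antitone fun n => (Bs n).1 := antitone_nat_of_succ_le fun n => hBB n (Bs n)
  let As : ℕ → Set M := fun n => A n (Bs n)
  have hsub : ∀ {n m : ℕ}, n < m → As m ⊆ (Bs (n + 1)).1 := fun h =>
    (hAB _ _).trans (hBs h)
  have hsepA : ∀ {n m : ℕ}, n ≠ m → ∀ v ∈ V, ∀ a ∈ As n, v • a ∉ As m := by
    intro n m hnm v hv a ha hva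
    obtain h | h := hnm.lt_or_gt
    · exact hsep n (Bs n) v hv a ha (hsub h hva)
    · refine hsep m (Bs m) v⁻¹ (hsymm v hv) _ hva ?_
      rw [inv_smul_smul]
      exact hsub h ha
  obtain ⟨ω, -, hω⟩ := hM.exists_modulus_separating hV
  obtain ⟨h, hcont, -, h0, h1⟩ := hω (⋃ n, As (2 * n)) (⋃ n, As (2 * n + 1))
    (isOpen_iUnion fun n => hAo _ _) (isOpen_iUnion fun n => hAo _ _) (by
      intro v hv a ha hva
      obtain ⟨n, hn⟩ := mem_iUnion.mp ha
      obtain ⟨m, hm⟩ := mem_iUnion.mp hva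
      exact hsepA (by omega) v hv a hn hm)
  have hy : Tendsto (fun n => h (y n (Bs n))) atTop (𝓝 (h x)) :=
    (hcont.tendsto x).comp (hU.tendsto fun n => hyU n (Bs n))
  have hx0 : h x = 0 := by
    refine tendsto_nhds_unique (hy.comp (StrictMono.tendsto_atTop (φ := fun n => 2 * n)
      fun a b hab => by dsimp only; omega)) ?_
    refine tendsto_const_nhds.congr fun n => (h0 _ (mem_iUnion.mpr ⟨n, ?_⟩)).symm
    exact hyA _ _
  have hx1 : h x = 1 := by
    refine tendsto_nhds_unique (hy.comp (StrictMono.tendsto_atTop (φ := fun n => 2 * n + 1)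
      fun a b hab => by dsimp only; omega)) ?_
    refine tendsto_const_nhds.congr fun n => (h1 _ (mem_iUnion.mpr ⟨n, ?_⟩)).symm
    exact hyA _ _
  exact zero_ne_one (hx0.symm.trans hx1)

/-- A first countable universal minimal flow is locally topologically transitive under every
neighbourhood of the identity. -/
theorem IsUniversalMinimalFlow.exists_nhds_locally_transitive [FirstCountableTopology M]
    (hM : IsUniversalMinimalFlow G M) {V : Set G} (hV : V ∈ 𝓝 (1 : G)) (x : M) :
    ∃ O ∈ 𝓝 x, ∀ A C : Set M, IsOpen A → IsOpen C → A.Nonempty → C.Nonempty → A ⊆ O → C ⊆ O →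
      ∃ v ∈ V, ∃ a ∈ A, v • a ∈ C := by
  obtain ⟨ω, hω, hsep⟩ := hM.exists_modulus_separating hV
  have hω' : ∀ᶠ w in 𝓝 (1 : G), ω w < 1 / 3 := hω.eventually (gt_mem_nhds (by norm_num))
  have hinv : Tendsto (fun w : G => w⁻¹) (𝓝 1) (𝓝 1) := by
    simpa using (continuous_inv (G := G)).tendsto 1
  obtain ⟨O, hO, hOsep⟩ := hM.exists_nhds_not_separated_from
    (hω'.and (hinv.eventually hω')) (fun w hw => ⟨hw.2, by simpa using hw.1⟩) x
  refine ⟨O, hO, fun A C hA hC ⟨a₀, ha₀⟩ ⟨c₀, hc₀⟩ hAO hCO => ?_⟩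
  by_contra! hneg
  obtain ⟨h, hcont, hmod, h0, h1⟩ := hsep A C hA hC hneg
  -- If `h x ≥ 1/2`, some `w` with `ω w < 1/3` takes a point of `A` from value 0 to above 1/3;
  -- otherwise a point of `C` drops from 1 to below 2/3.
  obtain hx | hx := le_or_gt (1 / 2) (h x)
  · obtain ⟨w, hw, a, ha, hwa⟩ := hOsep a₀ (hAO ha₀) A {z | 1 / 3 < h z} hA
      (isOpen_lt continuous_const hcont) ha₀ (show 1 / 3 < h x by linarith)
    have hw1 : ω w < 1 / 3 := hw.1
    have := (abs_sub_le_iff.mp (hmod w a)).1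
    rw [h0 a ha] at this
    rw [mem_ofPred_eq] at hwa
    linarith
  · obtain ⟨w, hw, c, hc, hwc⟩ := hOsep c₀ (hCO hc₀) C {z | h z < 2 / 3} hC
      (isOpen_lt hcont continuous_const) hc₀ (show h x < 2 / 3 by linarith)
    have hw1 : ω w < 1 / 3 := hw.1
    have := (abs_sub_le_iff.mp (hmod w c)).2
    rw [h1 c hc] at this
    rw [mem_ofPred_eq] at hwc
    linarith

end Separation

/-! ### Generic points have locally dense orbits. -/

section LocallyDense

variable {G M : Type u} [Group G] [TopologicalSpace G] [TopologicalSpace M] [MulAction G M]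

variable (G) in
/-- The orbit map at `x` sends neighbourhoods of points of the group to somewhere dense sets,
dense near the image point. -/
def HasLocallyDenseOrbit (x : M) : Prop :=
  ∀ u : G, ∀ W ∈ 𝓝 u, closure ((fun g : G => g • x) '' W) ∈ 𝓝 (u • x)

theorem hasLocallyDenseOrbit_of_one [IsTopologicalGroup G] [ContinuousConstSMul G M] {x : M}
    (h : ∀ V ∈ 𝓝 (1 : G), closure ((fun g : G => g • x) '' V) ∈ 𝓝 x) :
    HasLocallyDenseOrbit G x := by
  intro u W hW
  have hV : (fun g => u * g) ⁻¹' W ∈ 𝓝 (1 : G) :=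
    (continuous_const_mul u).continuousAt.preimage_mem_nhds (by rwa [mul_one])
  have himg := (Homeomorph.smul (α := M) u).isOpenMap.image_mem_nhds (h _ hV)
  refine mem_of_superset himg ?_
  rw [Homeomorph.image_closure]
  refine closure_mono ?_
  rintro _ ⟨_, ⟨g, hg, rfl⟩, rfl⟩
  exact ⟨u * g, hg, mul_smul _ _ _⟩

/-- Local topological transitivity gives comeagrely many points with locally dense orbits. -/
theorem eventually_residual_hasLocallyDenseOrbit [IsTopologicalGroup G] [FirstCountableTopology G]
    [SecondCountableTopology M] [ContinuousConstSMul G M]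
    (h : ∀ V ∈ 𝓝 (1 : G), ∀ x : M, ∃ O ∈ 𝓝 x, ∀ A C : Set M, IsOpen A → IsOpen C →
      A.Nonempty → C.Nonempty → A ⊆ O → C ⊆ O → ∃ v ∈ V, ∃ a ∈ A, v • a ∈ C) :
    ∀ᶠ x in residual M, HasLocallyDenseOrbit G x := by
  obtain ⟨V, hV⟩ := (𝓝 (1 : G)).exists_antitone_basis
  suffices hn : ∀ n, ∀ᶠ x in residual M, closure ((fun g : G => g • x) '' V n) ∈ 𝓝 x by
    filter_upwards [eventually_countable_forall.mpr hn] with x hx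
    refine hasLocallyDenseOrbit_of_one fun W hW => ?_
    obtain ⟨n, hn⟩ := hV.mem_iff.mp hW
    exact mem_of_superset (hx n) (closure_mono (image_mono hn))
  intro n
  choose O hO hOtrans using h (V n) (hV.mem n)
  obtain ⟨s, hs, hcover⟩ := TopologicalSpace.countable_cover_nhds fun x => interior_mem_nhds.mpr (hO x)
  have hres : ∀ x ∈ s, ∀ C ∈ countableBasis M, ∀ᶠ z in residual M, z ∈ interior (O x) →
      (C ∩ interior (O x)).Nonempty → ∃ v ∈ V n, v • z ∈ C := by
    intro x _ C hC
    by_cases hne : (C ∩ interior (O x)).Nonempty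
    swap
    · exact Eventually.of_forall fun _ _ h => absurd h hne
    have hCo := isOpen_of_mem_countableBasis hC
    -- The added complement makes this open set dense in all of `M`, not just in `interior (O x)`.
    have hmem : (⋃ v ∈ V n, (fun z : M => v • z) ⁻¹' C) ∪ (closure (interior (O x)))ᶜ ∈
        residual M := by
      refine residual_of_dense_open (IsOpen.union (isOpen_biUnion fun v _ =>
        hCo.preimage (continuous_const_smul v)) isClosed_closure.isOpen_compl) ?_
      rw [dense_iff_inter_open]
      intro A hA hAne
      by_cases hAO : (A ∩ interior (O x)).Nonempty
      · obtain ⟨v, hv, a, ha, hva⟩ := hOtrans x _ _ (hA.inter isOpen_interior)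
          (hCo.inter isOpen_interior) hAO hne (inter_subset_right.trans interior_subset)
          (inter_subset_right.trans interior_subset)
        exact ⟨a, ha.1, Or.inl (mem_biUnion hv hva.1)⟩
      · obtain ⟨a, ha⟩ := hAne
        refine ⟨a, ha, Or.inr fun hcl => hAO ?_⟩
        exact mem_closure_iff.mp hcl A hA ha
    filter_upwards [hmem] with z hz hzO _
    obtain hz | hz := hz
    · simpa using hz
    · exact absurd (subset_closure hzO) hz
  have hall : ∀ᶠ z in residual M, ∀ x ∈ s, ∀ C ∈ countableBasis M, z ∈ interior (O x) →
      (C ∩ interior (O x)).Nonempty → ∃ v ∈ V n, v • z ∈ C :=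
    (eventually_countable_ball hs).mpr fun x hx =>
      (eventually_countable_ball (countable_countableBasis M)).mpr fun C hC => hres x hx C hC
  filter_upwards [hall] with z hz
  obtain ⟨x, hx, hzx⟩ : ∃ x ∈ s, z ∈ interior (O x) := by
    simpa using (hcover ▸ mem_univ z : z ∈ ⋃ x ∈ s, interior (O x))
  refine mem_of_superset (isOpen_interior.mem_nhds hzx) fun y hy => ?_
  rw [(isBasis_countableBasis M).mem_closure_iff]
  intro C hC hyC
  obtain ⟨v, hv, hvz⟩ := hz x hx C hC hzx ⟨y, hyC, hy⟩
  exact ⟨v • z, hvz, v, hv, rfl⟩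

end LocallyDense

/-! ### Back-and-forth between two orbits. -/

section BackAndForth

variable {G M : Type u} [Group G] [MetricSpace G] [MetricSpace M] [MulAction G M]

/-- One half-step: `u` moves by less than `ε` and the density hypothesis passes to the other side,
ready for the roles of `x` and `y` to be swapped. -/
theorem HasLocallyDenseOrbit.exists_approx {x y : M} (hy : HasLocallyDenseOrbit G y) {u w : G}
    {ε ε' : ℝ} (hQ : closure ((fun g : G => g • x) '' Metric.ball u ε) ∈ 𝓝 (w • y))
    (hε' : 0 < ε') :
    ∃ u', dist u' u < ε ∧ dist (u' • x) (w • y) < ε' ∧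
      closure ((fun g : G => g • y) '' Metric.ball w ε') ∈ 𝓝 (u' • x) := by
  have hN := inter_mem (interior_mem_nhds.mpr (hy w _ (Metric.ball_mem_nhds w hε')))
    (Metric.ball_mem_nhds (w • y) hε')
  obtain ⟨_, ⟨hz1, hz2⟩, u', hu', rfl⟩ := mem_closure_iff_nhds.mp (mem_of_mem_nhds hQ) _ hN
  exact ⟨u', hu', hz2, mem_interior_iff_mem_nhds.mp hz1⟩

/-- Two points with locally dense orbits lie in the same orbit if the orbit of one of them is
dense. -/
theorem HasLocallyDenseOrbit.mem_orbit [CompleteSpace G] [ContinuousSMul G M] {x y : M}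
    (hx : HasLocallyDenseOrbit G x) (hy : HasLocallyDenseOrbit G y)
    (hdense : Dense (MulAction.orbit G y)) : y ∈ MulAction.orbit G x := by
  let Q : ℕ → G × G → Prop := fun n p =>
    closure ((fun g : G => g • x) '' Metric.ball p.1 ((1 / 2) ^ n)) ∈ 𝓝 (p.2 • y)
  have hstep : ∀ (n : ℕ) (p : G × G), ∃ q : G × G, Q n p → Q (n + 1) q ∧
      dist p.1 q.1 ≤ 1 * (1 / 2) ^ n ∧ dist p.2 q.2 ≤ 1 * (1 / 2) ^ n ∧
      dist (q.1 • x) (q.2 • y) ≤ (1 / 2) ^ (n + 1) := by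
    rintro n ⟨u, w⟩
    by_cases hQ : Q n (u, w)
    swap
    · exact ⟨(u, w), fun h => absurd h hQ⟩
    -- The radius `(1 / 2) ^ n` bounds the coming move of `w`; only the second half-step passes to
    -- `(1 / 2) ^ (n + 1)`.
    obtain ⟨u', hu', -, hQ'⟩ := hy.exists_approx hQ (ε' := (1 / 2) ^ n) (by positivity)
    obtain ⟨w', hw', hd, hQ''⟩ := hx.exists_approx hQ' (ε' := (1 / 2) ^ (n + 1)) (by positivity)
    refine ⟨(u', w'), fun _ => ⟨hQ'', ?_, ?_, ?_⟩⟩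
    · rw [one_mul, dist_comm]
      exact hu'.le
    · rw [one_mul, dist_comm]
      exact hw'.le
    · rw [dist_comm]
      exact hd.le
  choose F hF using hstep
  obtain ⟨w₀, hw₀⟩ : ∃ w₀ : G, Q 0 (1, w₀) := by
    have h1 := hx 1 _ (Metric.ball_mem_nhds 1 (show (0 : ℝ) < (1 / 2) ^ 0 by positivity))
    obtain ⟨_, hz, w₀, rfl⟩ := hdense.inter_open_nonempty _ isOpen_interior
      ⟨_, mem_interior_iff_mem_nhds.mpr h1⟩
    exact ⟨w₀, mem_interior_iff_mem_nhds.mp hz⟩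
  let p : ℕ → G × G := Nat.rec (1, w₀) F
  have hp : ∀ n, Q n (p n) := fun n => Nat.rec hw₀ (fun n ih => (hF n (p n) ih).1) n
  have hspec := fun n => (hF n (p n) (hp n)).2
  obtain ⟨u, hu⟩ := cauchySeq_tendsto_of_complete
    (cauchySeq_of_le_geometric (f := fun n => (p n).1) _ _ (by norm_num) fun n => (hspec n).1)
  obtain ⟨w, hw⟩ := cauchySeq_tendsto_of_complete
    (cauchySeq_of_le_geometric (f := fun n => (p n).2) _ _ (by norm_num) fun n => (hspec n).2.1)
  have hdist : Tendsto (fun n => dist ((p n).1 • x) ((p n).2 • y)) atTop (𝓝 0) := by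
    refine (tendsto_add_atTop_iff_nat 1).mp ?_
    refine squeeze_zero (fun _ => dist_nonneg) (fun n => (hspec n).2.2) ?_
    exact (tendsto_add_atTop_iff_nat 1).mpr
      (tendsto_pow_atTop_nhds_zero_of_lt_one (by norm_num) (by norm_num))
  have huw : u • x = w • y := dist_eq_zero.mp <| tendsto_nhds_unique
    ((hu.smul_const x).dist (hw.smul_const y)) hdist
  exact ⟨w⁻¹ * u, by simp only [mul_smul, huw, inv_smul_smul]⟩

end BackAndForth

theorem theorem1p2 (G : Type u) [Group G] [TopologicalSpace G] [IsTopologicalGroup G]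
    [PolishSpace G] (M : Type u) [TopologicalSpace M] [MulAction G M]
    (hM : IsUniversalMinimalFlow G M) (hmet : MetrizableSpace M) :
    ∃ x : M, MulAction.orbit G x ∈ residual M := by
  have := hM.compactSpace
  have := hM.nonempty
  have := hM.continuousSMul
  let _ := upgradeIsCompletelyMetrizable G
  let _ : MetricSpace M := metrizableSpaceMetric M
  have hres := eventually_residual_hasLocallyDenseOrbit (G := G) (M := M)
    fun V hV x => hM.exists_nhds_locally_transitive hV x
  -- Compact Hausdorff spaces are Baire, so the residual set is nonempty; it lies in a single orbit.
  obtain ⟨x, hx⟩ := (dense_of_mem_residual hres).nonempty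
  exact ⟨x, mem_of_superset hres fun y hy => hx.mem_orbit hy (hM.dense_orbit y)⟩
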